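/- Fix $p\in[0,1/2)$. An unknown permutation $\pi$ of $\{1,\dots,n\}$ describes the order $\theta_{\pi(1)}<\theta_{\pi(2)}<\dots<\theta_{\pi(n)}$ of $n$ distinct reals. At time step $k$ an agent submits a pair of distinct indices $(i,j)$ and receives the response $Y_k=\mathbb 1\{\theta_i<\theta_j\}\oplus Z_k$, where $Z_1,Z_2,\dots$ are i.i.d. $\mathrm{Bern}(p)$. A noisy sorting code for $n$ elements consists of a querying strategy, in which each query may depend on the past queries and responses (and on private randomness independent of the noise), a stopping time $M$ determined in the same causal way, and an estimate $\hat\Pi$ of $\pi$ that is a function of the queries and responses up to time $M$ (and of the private randomness). A run that never stops counts as an error. $\mathbb E[M]$ denotes the expected number of queries when the true permutation is uniformly distributed, and the code has sorting rate $R>0$ if $\mathbb E[M]=\frac{n\log_2 n}{R}$. The rate $R$ is achievable if there is a sequence of codes of rate $R$, one for each $n$, with $\lim_{n\to\infty}\max_\pi\mathbb P\{\hat\Pi\ne\pi\}=0$. The noisy sorting capacity $C(p)$ is the supremum of all achievable rates. Let $H(p)=-p\log_2p-(1-p)\log_2(1-p)$ (with $0\log_2 0=0$). Then $$C(p)\le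 1-H(p).$$ Moreover, every sequence of noisy sorting codes (one for each $n$, of whatever rate) with $\max_\pi\mathbb P\{\hat\Pi\neq\pi\}\to0$ satisfies $(1-o(1))\,\log_2(n!)\le \mathbb E[M]\,(1-H(p))$. -/

import Mathlib

open MeasureTheory ProbabilityTheory Filter Topology
open scoped ENNReal Nat

namespace NoisySorting

/-- A query: a pair `(i, j)` of distinct indices, asking whether `θ i < θ j`. -/
abbrev Query (n : ℕ) : Type := {q : Fin n × Fin n // q.1 ≠ q.2}

/-- The information gathered so far: the submitted queries together with the noisy
responses, the most recent one first. -/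
abbrev History (n : ℕ) : Type := List (Query n × Bool)

/-- A (randomized, adaptive, variable-length) noisy sorting code for `n` elements.
The agent draws a private random seed once, independently of the observation noise. The next query
is a function of the seed and of the past queries and responses; the value `none` means that
the agent stops, so that the stopping time is also determined causally. The estimate of the
ordering is a function of the seed and of the history at the stopping time.
A deterministic code is one with a one-point seed space. -/
structure NoisySortingCode (n : ℕ) where
  /-- the space of the private randomness -/
  Seed : Type
  [measurableSpaceSeed : MeasurableSpace Seed]
  /-- the law of the private randomness -/
  seedLaw : Measure Seed
  [isProbabilityMeasure_seedLaw : IsProbabilityMeasure seedLaw]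
  /-- the querying strategy; `none` means: stop -/
  query : Seed → History n → Option (Query n)
  measurableSet_query : ∀ h a, MeasurableSet {ω | query ω h = a}
  /-- the estimator -/
  estimate : Seed → History n → Equiv.Perm (Fin n)
  measurableSet_estimate : ∀ h σ, MeasurableSet {ω | estimate ω h = σ}

attribute [instance] NoisySortingCode.measurableSpaceSeed
  NoisySortingCode.isProbabilityMeasure_seedLaw

/-- The noiseless answer to the query `(i, j)` when the ordering is `π`, that is, when
`θ (π 0) < θ (π 1) < ⋯ < θ (π (n - 1))`: is `θ i < θ j`? (See `trueAnswer_eq`.) -/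
def trueAnswer {n : ℕ} (π : Equiv.Perm (Fin n)) (q : Query n) : Bool :=
  decide (π.symm q.1.1 < π.symm q.1.2)

theorem trueAnswer_eq {n : ℕ} (θ : Fin n → ℝ) (π : Equiv.Perm (Fin n))
    (hθ : StrictMono fun k => θ (π k)) (q : Query n) :
    trueAnswer π q = true ↔ θ q.1.1 < θ q.1.2 := by
  have h := hθ.lt_iff_lt (a := π.symm q.1.1) (b := π.symm q.1.2)
  simp only [Equiv.apply_symm_apply] at h
  simp [trueAnswer, h]

/-- The law of the noise sequence: i.i.d. Bernoulli(`p`) bits (`true` means: flipped). -/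
noncomputable def noiseLaw (p : unitInterval) : Measure (ℕ → Bool) :=
  Measure.infinitePi fun _ : ℕ => bernoulliMeasure true false p

namespace NoisySortingCode

variable {n : ℕ} (c : NoisySortingCode n)

/-- The history after `k` time steps when the ordering is `π`, the seed is `ω` and the noise
sequence is `z`; it no longer changes once the agent has stopped. The response to a query is its
noiseless answer, XORed with the noise bit of that time step. -/
def history (π : Equiv.Perm (Fin n)) (ω : c.Seed) (z : ℕ → Bool) : ℕ → History n
  | 0 => []
  | k + 1 =>
    match c.query ω (history π ω z k) with
    | none => history π ω z k
    | some q => (q, xor (trueAnswer π q) (z k)) :: history π ω z k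

/-- The agent has stopped after at most `k` queries. -/
def StoppedBy (π : Equiv.Perm (Fin n)) (ω : c.Seed) (z : ℕ → Bool) (k : ℕ) : Prop :=
  c.query ω (c.history π ω z k) = none

/-- The number `M` of queries: the first time at which the agent stops (`∞` if it never
does). -/
noncomputable def numQueries (π : Equiv.Perm (Fin n)) (ω : c.Seed) (z : ℕ → Bool) : ℝ≥0∞ :=
  ⨅ (k : ℕ) (_ : c.StoppedBy π ω z k), (k : ℝ≥0∞)

/-- The agent stops and its estimate is the true ordering. -/
def Correct (π : Equiv.Perm (Fin n)) (ω : c.Seed) (z : ℕ → Bool) : Prop :=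
  ∃ k, c.StoppedBy π ω z k ∧ c.estimate ω (c.history π ω z k) = π

/-- The probability `ℙ(Π̂ ≠ π)` that the estimate is wrong when the true ordering is `π`. -/
noncomputable def errorProb (p : unitInterval) (π : Equiv.Perm (Fin n)) : ℝ≥0∞ :=
  (c.seedLaw.prod (noiseLaw p)) {x | ¬ c.Correct π x.1 x.2}

/-- The expected number `𝔼[M]` of queries, for a uniformly distributed true ordering. -/
noncomputable def expectedQueries (p : unitInterval) : ℝ≥0∞ :=
  (∑ π : Equiv.Perm (Fin n),
    ∫⁻ x, c.numQueries π x.1 x.2 ∂(c.seedLaw.prod (noiseLaw p))) / (n ! : ℝ≥0∞)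

/-- The code has sorting rate `R`, that is, `𝔼[M] = n log₂ n / R`. -/
def HasRate (p : unitInterval) (R : ℝ) : Prop :=
  0 < R ∧ c.expectedQueries p = ENNReal.ofReal (n * Real.logb 2 n / R)

end NoisySortingCode

/-- The worst-case error probability of a sequence of codes tends to zero. -/
def VanishingError (p : unitInterval) (c : (n : ℕ) → NoisySortingCode n) : Prop :=
  Tendsto (fun n => ⨆ π : Equiv.Perm (Fin n), (c n).errorProb p π) atTop (𝓝 0)

/-- The sorting rate `R` is achievable. -/
def IsAchievable (p : unitInterval) (R : ℝ) : Prop :=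
  ∃ c : (n : ℕ) → NoisySortingCode n, (∀ n, (c n).HasRate p R) ∧ VanishingError p c

/-- The noisy sorting capacity `C(p)`: the supremum of the achievable sorting rates, taken in the
extended reals. -/
noncomputable def capacity (p : unitInterval) : EReal :=
  ⨆ (R : ℝ) (_ : IsAchievable p R), (R : EReal)

/-- The binary entropy function `H(p)`, in bits. -/
noncomputable def binaryEntropy (p : ℝ) : ℝ := Real.binEntropy p / Real.log 2

end NoisySorting

/-! The proof is a Fano-type converse, obtained by a change of measure to fair noise. Put `N = n!`
and fix the seed and a horizon `k`. If the noise bits were fair, the responses would be independent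
of the ordering (`mean_half_eq`), so the success probabilities `q π` under fair noise would sum over
all orderings to at most 1. Each query moves the true response law away from fair coin flips by
divergence at most `log 2 - h(p)`, with `h` the entropy in nats, so a Donsker–Varadhan inequality
(`mean_le`) bounds the mean of any `f` by this amount times the expected number of queries, plus the
log of the fair-noise mean of `exp f`.

Take `f = log N` on success and 0 otherwise. The last term is `log (1 + (N - 1) * q π)`, whose
average over `π` is at most `log 2` by concavity. Hence `log N` times the average success
probability is at most `(log 2 - h(p)) * 𝔼[M] + log 2`. Integrating over seeds and letting `k → ∞`
gives the bound for the code; after division by `log 2` the additive constant is one bit, negligible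
against `log₂ n!`. Stirling's bound turns this into the capacity statement. -/

namespace NoisySorting

/-! ### Gibbs inequality for a single noise bit. -/

/-- One term of the Gibbs variational inequality. -/
theorem mul_sub_log_sub_le {p : ℝ} (hp : 0 ≤ p) (y L : ℝ) :
    p * (y - Real.log p - L) ≤ Real.exp (y - L) - p := by
  rcases hp.eq_or_lt with rfl | hp
  · simpa using (Real.exp_pos _).le
  · have h := Real.add_one_le_exp (y - L - Real.log p)
    rw [Real.exp_sub _ (Real.log p), Real.exp_log hp, le_div_iff₀ hp] at h
    linarith

/-- The Gibbs variational inequality for a Bernoulli law relative to the fair coin. -/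
theorem bernoulli_mean_le {p : ℝ} (hp0 : 0 ≤ p) (hp1 : p ≤ 1) (x y : ℝ) :
    p * y + (1 - p) * x ≤ (Real.log 2 - Real.binEntropy p) +
      Real.log (1 / 2 * Real.exp y + (1 - 1 / 2) * Real.exp x) := by
  set S := Real.exp y + Real.exp x with hS
  have hSpos : 0 < S := by positivity
  have e : 1 / 2 * Real.exp y + (1 - 1 / 2) * Real.exp x = S / 2 := by rw [hS]; ring
  -- The choice `L = log S` normalizes the two exponentials to a probability vector, so the
  -- right-hand sides add up to 0.
  have h1 := mul_sub_log_sub_le hp0 y (Real.log S)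
  have h2 := mul_sub_log_sub_le (sub_nonneg.2 hp1) x (Real.log S)
  rw [Real.exp_sub, Real.exp_log hSpos] at h1 h2
  have h3 : Real.exp y / S + Real.exp x / S = 1 := by
    rw [← add_div, ← hS, div_self hSpos.ne']
  rw [e, Real.log_div hSpos.ne' two_ne_zero, Real.binEntropy, Real.log_inv, Real.log_inv]
  linarith

/-! ### Finite-horizon means and the change of measure to fair noise. -/

namespace NoisySortingCode

variable {n : ℕ} (c : NoisySortingCode n) (π : Equiv.Perm (Fin n)) (ω : c.Seed)

/-- The history after one more time step with noise bit `b`. -/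
def step (h : History n) (b : Bool) : History n :=
  match c.query ω h with
  | none => h
  | some q => (q, xor (trueAnswer π q) b) :: h

theorem history_succ (z : ℕ → Bool) (k : ℕ) :
    c.history π ω z (k + 1) = c.step π ω (c.history π ω z k) (z k) := rfl

theorem step_of_none {h : History n} (hq : c.query ω h = none) (b : Bool) :
    c.step π ω h b = h := by
  simp [step, hq]

/-- The conditional mean of `F` after one more time step with noise bit of law `Bern(r)`. -/
def stepMean (r : ℝ) (F : History n → ℝ) (h : History n) : ℝ :=
  r * F (c.step π ω h true) + (1 - r) * F (c.step π ω h false)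

/-- The mean of `F` at the history after `k` time steps, for noise bits of law `Bern(r)`. -/
def mean (r : ℝ) : ℕ → (History n → ℝ) → ℝ
  | 0, F => F []
  | k + 1, F => mean r k (c.stepMean π ω r F)

variable {c π ω}

theorem stepMean_mono {r : ℝ} (h0 : 0 ≤ r) (h1 : r ≤ 1) {F G : History n → ℝ}
    (h : ∀ x, F x ≤ G x) (x : History n) : c.stepMean π ω r F x ≤ c.stepMean π ω r G x := by
  have := sub_nonneg.2 h1
  unfold stepMean
  gcongr <;> apply h

theorem mean_mono {r : ℝ} (h0 : 0 ≤ r) (h1 : r ≤ 1) {F G : History n → ℝ}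
    (h : ∀ x, F x ≤ G x) (k : ℕ) : c.mean π ω r k F ≤ c.mean π ω r k G := by
  induction k generalizing F G with
  | zero => exact h _
  | succ k ih => exact ih (stepMean_mono h0 h1 h)

theorem mean_const (r a : ℝ) (k : ℕ) : c.mean π ω r k (fun _ => a) = a := by
  induction k with
  | zero => rfl
  | succ k ih =>
    have : c.stepMean π ω r (fun _ => a) = fun _ => a := by
      funext h; simp only [stepMean]; ring
    rw [mean, this, ih]

theorem mean_add (r : ℝ) (F G : History n → ℝ) (k : ℕ) :
    c.mean π ω r k (fun h => F h + G h) = c.mean π ω r k F + c.mean π ω r k G := by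
  induction k generalizing F G with
  | zero => rfl
  | succ k ih =>
    rw [mean, mean, mean, ← ih]
    congr 1; funext h; simp only [stepMean]; ring

theorem mean_const_mul (r a : ℝ) (F : History n → ℝ) (k : ℕ) :
    c.mean π ω r k (fun h => a * F h) = a * c.mean π ω r k F := by
  induction k generalizing F with
  | zero => rfl
  | succ k ih =>
    rw [mean, mean, ← ih]
    congr 1; funext h; simp only [stepMean]; ring

theorem mean_sum {ι : Type*} (s : Finset ι) (r : ℝ) (F : ι → History n → ℝ) (k : ℕ) :
    c.mean π ω r k (fun h => ∑ i ∈ s, F i h) = ∑ i ∈ s, c.mean π ω r k (F i) := by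
  classical
  induction s using Finset.induction_on with
  | empty => simpa using mean_const r 0 k
  | insert i s hi ih => simp only [Finset.sum_insert hi, mean_add, ih]

theorem mean_nonneg {r : ℝ} (h0 : 0 ≤ r) (h1 : r ≤ 1) {F : History n → ℝ}
    (h : ∀ x, 0 ≤ F x) (k : ℕ) : 0 ≤ c.mean π ω r k F := by
  simpa [mean_const] using mean_mono (c := c) (π := π) (ω := ω) h0 h1 h k

/-- With fair noise bits, the responses carry no information about the ordering. -/
theorem mean_half_eq (π σ : Equiv.Perm (Fin n)) (k : ℕ) (F : History n → ℝ) :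
    c.mean π ω (1 / 2) k F = c.mean σ ω (1 / 2) k F := by
  induction k generalizing F with
  | zero => rfl
  | succ k ih =>
    have : c.stepMean π ω (1 / 2) F = c.stepMean σ ω (1 / 2) F := by
      funext h
      unfold stepMean step
      rcases c.query ω h with _ | q
      · rfl
      · dsimp only
        -- Changing the true answer at most swaps the two branches, which have equal weight.
        generalize trueAnswer π q = a
        generalize trueAnswer σ q = b
        cases a <;> cases b <;> simp only [Bool.xor_true, Bool.xor_false, Bool.not_true,
          Bool.not_false] <;> ring
    rw [mean, mean, this, ih]

/-- One step of the chain rule for divergence: a query lengthens the history by one and costs `log 2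
- h(p)`, whereas a stopped agent pays nothing. -/
theorem stepMean_le {p : ℝ} (h0 : 0 ≤ p) (h1 : p ≤ 1) (f : History n → ℝ) (h : History n) :
    c.stepMean π ω p f h ≤
      (Real.log 2 - Real.binEntropy p) *
        (c.stepMean π ω p (fun h => (h.length : ℝ)) h - h.length) +
      Real.log (c.stepMean π ω (1 / 2) (fun h => Real.exp (f h)) h) := by
  rcases hq : c.query ω h with _ | q
  · simp only [stepMean, step_of_none c π ω hq, ← add_mul, add_sub_cancel, one_mul, Real.log_exp]
    simp
  · have e : c.stepMean π ω p (fun h => (h.length : ℝ)) h - h.length = 1 := by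
      simp only [stepMean, step, hq, List.length_cons]; push_cast; ring
    rw [e, mul_one]
    exact bernoulli_mean_le h0 h1 _ _

/-- The Donsker–Varadhan inequality for the interaction up to time `k`: the divergence of the
responses from fair coin flips is `log 2 - h(p)` per query. -/
theorem mean_le {p : ℝ} (h0 : 0 ≤ p) (h1 : p ≤ 1) (f : History n → ℝ) (k : ℕ) :
    c.mean π ω p k f ≤
      (Real.log 2 - Real.binEntropy p) * c.mean π ω p k (fun h => (h.length : ℝ)) +
      Real.log (c.mean π ω (1 / 2) k (fun h => Real.exp (f h))) := by
  induction k generalizing f with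
  | zero => simp [mean]
  | succ k ih =>
    set d := Real.log 2 - Real.binEntropy p
    set len : History n → ℝ := fun h => (h.length : ℝ) with hlen
    -- With this choice `exp g` is the fair-noise conditional mean of `exp f`, so the induction
    -- hypothesis for `g` absorbs the last step.
    set g : History n → ℝ := fun h =>
      Real.log (c.stepMean π ω (1 / 2) (fun h => Real.exp (f h)) h) with hg
    have hexp : (fun h => Real.exp (g h)) = c.stepMean π ω (1 / 2) (fun h => Real.exp (f h)) := by
      funext h
      refine Real.exp_log ?_
      unfold stepMean
      norm_num
      positivity
    have h2 := ih g
    rw [hexp] at h2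
    have h3 : c.mean π ω p k (c.stepMean π ω p f) ≤
        c.mean π ω p k (fun h => (d * c.stepMean π ω p len h + (-d) * len h) + g h) := by
      refine mean_mono h0 h1 (fun h => ?_) k
      have := stepMean_le (c := c) (π := π) (ω := ω) h0 h1 f h
      simp only [hg, hlen]
      linarith
    rw [mean_add, mean_add, mean_const_mul, mean_const_mul] at h3
    change c.mean π ω p k (c.stepMean π ω p f) ≤ d * c.mean π ω p k (c.stepMean π ω p len) + _
    change _ ≤ _ + Real.log (c.mean π ω (1 / 2) k (c.stepMean π ω (1 / 2) _))
    linarith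

/-! ### Fano-type bound on the success probability. -/

variable (c π ω) in
open Classical in
/-- The indicator that the agent stops at history `h` with estimate `π`. -/
noncomputable def success (h : History n) : ℝ :=
  if c.query ω h = none ∧ c.estimate ω h = π then 1 else 0

theorem success_nonneg (h : History n) : 0 ≤ c.success π ω h := by
  unfold success; split_ifs <;> norm_num

theorem sum_success_le (h : History n) : ∑ π, c.success π ω h ≤ 1 := by
  classical
  calc ∑ π, c.success π ω h ≤ ∑ π, if c.estimate ω h = π then (1 : ℝ) else 0 := by
        refine Finset.sum_le_sum fun π _ => ?_
        unfold success
        split_ifs <;> simp_all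
    _ = 1 := by simp

/-- Under fair noise all orderings induce the same law of histories, and one history can be a
success for at most one of them. -/
theorem sum_mean_half_success_le (k : ℕ) :
    ∑ π, c.mean π ω (1 / 2) k (c.success π ω) ≤ 1 := by
  rw [Finset.sum_congr rfl fun π _ => mean_half_eq (c := c) (ω := ω) π 1 k _, ← mean_sum]
  calc _ ≤ c.mean 1 ω (1 / 2) k (fun _ => 1) :=
        mean_mono (by norm_num) (by norm_num) sum_success_le k
    _ = 1 := mean_const _ _ _

theorem mean_half_exp_success (k : ℕ) {N : ℝ} (hN : 0 < N) :
    c.mean π ω (1 / 2) k (fun h => Real.exp (Real.log N * c.success π ω h)) =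
      1 + (N - 1) * c.mean π ω (1 / 2) k (c.success π ω) := by
  have : (fun h => Real.exp (Real.log N * c.success π ω h)) =
      fun h => 1 + (N - 1) * c.success π ω h := by
    funext h
    unfold success
    split_ifs <;> simp [Real.exp_log hN]
  rw [this, mean_add, mean_const, mean_const_mul]

/-- Tangent line at `u = 2`, chosen because `1 + (N - 1) * q π` averages to at most 2 over the
orderings; this replaces Jensen's inequality. -/
theorem log_le_half {u : ℝ} (hu : 0 < u) : Real.log u ≤ Real.log 2 + u / 2 - 1 := by
  have := Real.log_le_sub_one_of_pos (half_pos hu)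
  rw [Real.log_div hu.ne' two_ne_zero] at this
  linarith

/-- The converse for a fixed seed and a bounded number of queries. -/
theorem log_mul_sum_mean_success_le {p : ℝ} (h0 : 0 ≤ p) (h1 : p ≤ 1) (k : ℕ) :
    Real.log (n ! : ℝ) * ∑ π, c.mean π ω p k (c.success π ω) ≤
      (Real.log 2 - Real.binEntropy p) * ∑ π, c.mean π ω p k (fun h => (h.length : ℝ)) +
      n ! * Real.log 2 := by
  have hN : (1 : ℝ) ≤ (n ! : ℝ) := by exact_mod_cast Nat.factorial_pos n
  have hcard : (Finset.univ : Finset (Equiv.Perm (Fin n))).card = n ! := by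
    simp [Fintype.card_perm]
  have key : ∀ π, Real.log (n ! : ℝ) * c.mean π ω p k (c.success π ω) ≤
      (Real.log 2 - Real.binEntropy p) * c.mean π ω p k (fun h => (h.length : ℝ)) +
      ((Real.log 2 - 1 / 2) + ((n ! : ℝ) - 1) / 2 * c.mean π ω (1 / 2) k (c.success π ω)) := by
    intro π
    have h2 := mean_le (c := c) (π := π) (ω := ω) h0 h1
      (fun h => Real.log (n ! : ℝ) * c.success π ω h) k
    rw [mean_const_mul, mean_half_exp_success k (by linarith)] at h2
    have h3 : 0 ≤ c.mean π ω (1 / 2) k (c.success π ω) :=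
      mean_nonneg (by norm_num) (by norm_num) success_nonneg k
    have h4 := log_le_half (u := 1 + ((n ! : ℝ) - 1) * c.mean π ω (1 / 2) k (c.success π ω))
      (by have := mul_nonneg (sub_nonneg.2 hN) h3; linarith)
    linarith
  have h5 := Finset.sum_le_sum fun π (_ : π ∈ Finset.univ) => key π
  rw [← Finset.mul_sum, Finset.sum_add_distrib, Finset.sum_add_distrib, ← Finset.mul_sum,
    ← Finset.mul_sum, Finset.sum_const, hcard, nsmul_eq_mul] at h5
  have h6 := mul_le_mul_of_nonneg_left (sum_mean_half_success_le (c := c) (ω := ω) k)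
    (div_nonneg (sub_nonneg.2 hN) zero_le_two)
  linarith

end NoisySortingCode
end NoisySorting

/-! ### From the recursive means to the product measure. -/

namespace NoisySorting

instance (p : unitInterval) : IsProbabilityMeasure (noiseLaw p) := by
  unfold noiseLaw; infer_instance

theorem noiseLaw_eval (p : unitInterval) (k : ℕ) (b : Bool) :
    noiseLaw p {z | z k = b} = ENNReal.ofReal (if b then (p : ℝ) else 1 - p) := by
  have h := Measure.infinitePi_map_eval (fun _ : ℕ => bernoulliMeasure true false p) k
  have h2 := congrArg (fun μ : Measure Bool => μ {b}) h
  rw [Measure.map_apply (measurable_pi_apply k) (measurableSet_singleton b)] at h2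
  change noiseLaw p {z | z k = b} = _ at h2
  rw [h2]
  cases b
  · rw [bernoulliMeasure_apply_of_notMem_of_mem _ (measurableSet_singleton _) (by simp) (by simp),
      ← ENNReal.ofReal_coe_nnreal]
    simp
  · rw [bernoulliMeasure_apply_of_mem_of_notMem _ (measurableSet_singleton _) (by simp) (by simp),
      ← ENNReal.ofReal_coe_nnreal]
    simp

/-- The noise bit at time `k` is independent of the earlier ones. -/
theorem lintegral_noiseLaw_restrict (p : unitInterval) (k : ℕ)
    (Φ : (Finset.range k → Bool) → Bool → ℝ≥0∞) :
    ∫⁻ z, Φ (fun i => z i) (z k) ∂noiseLaw p =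
      ∫⁻ z, (ENNReal.ofReal p * Φ (fun i => z i) true +
        ENNReal.ofReal (1 - p) * Φ (fun i => z i) false) ∂noiseLaw p := by
  have hind : iIndepFun (fun (i : ℕ) (z : ℕ → Bool) => z i) (noiseLaw p) :=
    iIndepFun_infinitePi (P := fun _ : ℕ => bernoulliMeasure true false p)
      (X := fun _ x => x) fun _ => measurable_id
  have h2 := hind.indepFun_finset (Finset.range k) {k} (by simp) fun i => measurable_pi_apply i
  have hm1 : Measurable fun (z : ℕ → Bool) (i : Finset.range k) => z i := by fun_prop
  have hm2 : ∀ b, Measurable fun z : ℕ → Bool => Φ (fun i => z i) b := fun b =>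
    (measurable_of_countable fun w => Φ w b).comp hm1
  have hm3 : ∀ b, MeasurableSet {z : ℕ → Bool | z k = b} := fun b =>
    measurableSet_eq_fun (measurable_pi_apply k) measurable_const
  have key : ∀ b, ∫⁻ z, Φ (fun i => z i) b * ({z : ℕ → Bool | z k = b}.indicator 1 z)
      ∂noiseLaw p = ENNReal.ofReal (if b then (p : ℝ) else 1 - p) *
        ∫⁻ z, Φ (fun i => z i) b ∂noiseLaw p := by
    intro b
    have h3 := h2.comp (measurable_of_countable fun w => Φ w b)
      (measurable_of_countable fun w : (({k} : Finset ℕ) → Bool) =>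
        ({b} : Set Bool).indicator (1 : Bool → ℝ≥0∞) (w ⟨k, by simp⟩))
    have h4 := lintegral_mul_eq_lintegral_mul_lintegral_of_indepFun (hm2 b)
      ((measurable_one.indicator (hm3 b)) :
        Measurable ({z : ℕ → Bool | z k = b}.indicator (1 : (ℕ → Bool) → ℝ≥0∞))) h3
    simp only [Pi.mul_apply] at h4
    rw [h4, lintegral_indicator_one (hm3 b), noiseLaw_eval, mul_comm]
  rw [lintegral_add_left ((hm2 true).const_mul _), lintegral_const_mul _ (hm2 true),
    lintegral_const_mul _ (hm2 false)]
  have k1 := key true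
  have k2 := key false
  simp only [if_true, Bool.false_eq_true, if_false] at k1 k2
  have hm4 : Measurable fun z : ℕ → Bool =>
      Φ (fun i => z i) true * ({z : ℕ → Bool | z k = true}.indicator 1 z) :=
    (hm2 true).mul (measurable_one.indicator (hm3 true))
  rw [← k1, ← k2, ← lintegral_add_left hm4]
  refine lintegral_congr fun z => ?_
  rcases hz : z k <;> simp [hz]

namespace NoisySortingCode

variable {n : ℕ} {c : NoisySortingCode n} {π : Equiv.Perm (Fin n)} {ω : c.Seed}

theorem history_congr {z w : ℕ → Bool} {k : ℕ} (h : ∀ i < k, z i = w i) :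
    c.history π ω z k = c.history π ω w k := by
  induction k with
  | zero => rfl
  | succ k ih =>
    rw [history_succ, history_succ, ih fun i hi => h i (hi.trans k.lt_succ_self),
      h k k.lt_succ_self]

theorem lintegral_history (p : unitInterval) (k : ℕ) {F : History n → ℝ} (hF : ∀ h, 0 ≤ F h) :
    ∫⁻ z, ENNReal.ofReal (F (c.history π ω z k)) ∂noiseLaw p =
      ENNReal.ofReal (c.mean π ω p k F) := by
  have hp0 : (0 : ℝ) ≤ p := p.2.1
  have hp1 : (0 : ℝ) ≤ 1 - p := sub_nonneg.2 p.2.2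
  induction k generalizing F with
  | zero => simp [history, mean]
  | succ k ih =>
    -- Padding with `false` makes the history at time `k` a function of the first `k` bits alone, as
    -- the independence lemma requires.
    let ext : (Finset.range k → Bool) → ℕ → Bool := fun w i =>
      if hi : i ∈ Finset.range k then w ⟨i, hi⟩ else false
    have hext : ∀ z : ℕ → Bool,
        c.history π ω (ext fun i => z i) k = c.history π ω z k := fun z =>
      history_congr fun i hi => by simp [ext, hi]
    have h1 := lintegral_noiseLaw_restrict p k fun w b =>
      ENNReal.ofReal (F (c.step π ω (c.history π ω (ext w) k) b))
    simp only [hext] at h1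
    simp only [history_succ]
    rw [h1, mean, ← ih (F := c.stepMean π ω p F)
      fun h => add_nonneg (mul_nonneg hp0 (hF _)) (mul_nonneg hp1 (hF _))]
    refine lintegral_congr fun z => ?_
    rw [← ENNReal.ofReal_mul hp0, ← ENNReal.ofReal_mul hp1, ← ENNReal.ofReal_add
      (mul_nonneg hp0 (hF _)) (mul_nonneg hp1 (hF _))]
    rfl

/-- Histories form a countable type, so measurability reduces to countable unions over the preceding
history, the agent's action and the noise bit. -/
theorem measurableSet_history_eq (c : NoisySortingCode n) (π : Equiv.Perm (Fin n)) (k : ℕ)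
    (h : History n) :
    MeasurableSet {x : c.Seed × (ℕ → Bool) | c.history π x.1 x.2 k = h} := by
  induction k generalizing h with
  | zero => exact .const (([] : History n) = h)
  | succ k ih =>
    have : {x : c.Seed × (ℕ → Bool) | c.history π x.1 x.2 (k + 1) = h} =
        ⋃ (h' : History n) (a : Option (Query n)) (b : Bool)
          (_ : (match a with
            | none => h'
            | some q => (q, xor (trueAnswer π q) b) :: h') = h),
          {x : c.Seed × (ℕ → Bool) | c.history π x.1 x.2 k = h'} ∩
            (Prod.fst ⁻¹' {ω | c.query ω h' = a} ∩ Prod.snd ⁻¹' {z | z k = b}) := by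
      ext x
      simp only [Set.mem_ofPred_eq, Set.mem_iUnion, Set.mem_inter_iff, Set.mem_preimage,
        exists_prop]
      constructor
      · exact fun hx => ⟨_, _, _, hx, rfl, rfl, rfl⟩
      · rintro ⟨_, _, _, hx, rfl, rfl, rfl⟩
        exact hx
    rw [this]
    refine .iUnion fun h' => .iUnion fun a => .iUnion fun b => .iUnion fun _ => (ih h').inter
      ((measurable_fst (c.measurableSet_query h' a)).inter (measurable_snd ?_))
    exact measurableSet_eq_fun (measurable_pi_apply k) measurable_const

theorem measurableSet_stoppedBy_estimate (c : NoisySortingCode n) (π : Equiv.Perm (Fin n))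
    (k : ℕ) :
    MeasurableSet {x : c.Seed × (ℕ → Bool) | c.StoppedBy π x.1 x.2 k ∧
      c.estimate x.1 (c.history π x.1 x.2 k) = π} := by
  have : {x : c.Seed × (ℕ → Bool) | c.StoppedBy π x.1 x.2 k ∧
      c.estimate x.1 (c.history π x.1 x.2 k) = π} =
      ⋃ h : History n, {x : c.Seed × (ℕ → Bool) | c.history π x.1 x.2 k = h} ∩
        Prod.fst ⁻¹' ({ω | c.query ω h = none} ∩ {ω | c.estimate ω h = π}) := by
    ext x
    simp [StoppedBy]
  rw [this]
  exact .iUnion fun h => (measurableSet_history_eq c π k h).inter (measurable_fst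
    ((c.measurableSet_query h none).inter (c.measurableSet_estimate h π)))

theorem measurable_length_history (c : NoisySortingCode n) (π : Equiv.Perm (Fin n)) (k : ℕ) :
    Measurable fun x : c.Seed × (ℕ → Bool) => (c.history π x.1 x.2 k).length := by
  refine measurable_to_countable' fun m => ?_
  have : (fun x : c.Seed × (ℕ → Bool) => (c.history π x.1 x.2 k).length) ⁻¹' {m} =
      ⋃ (h : History n) (_ : h.length = m),
        {x : c.Seed × (ℕ → Bool) | c.history π x.1 x.2 k = h} := by
    ext x; simp
  rw [this]
  exact .iUnion fun h => .iUnion fun _ => measurableSet_history_eq c π k h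

theorem StoppedBy.history_eq {z : ℕ → Bool} {j k : ℕ} (hj : c.StoppedBy π ω z j) (hjk : j ≤ k) :
    c.history π ω z k = c.history π ω z j := by
  induction k, hjk using Nat.le_induction with
  | base => rfl
  | succ k _ ih => rw [history_succ, ih, step_of_none c π ω hj]

theorem length_history_le (z : ℕ → Bool) (k : ℕ) : (c.history π ω z k).length ≤ k := by
  induction k with
  | zero => simp [history]
  | succ k ih =>
    rw [history_succ, step]
    split
    · exact ih.trans k.le_succ
    · simpa using ih

theorem length_history_le_numQueries (z : ℕ → Bool) (k : ℕ) :
    ((c.history π ω z k).length : ℝ≥0∞) ≤ c.numQueries π ω z := by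
  refine le_iInf₂ fun j hj => Nat.cast_le.2 ?_
  rcases le_total j k with h | h
  · rw [hj.history_eq h]
    exact length_history_le z j
  · exact (length_history_le z k).trans h

/-- The converse bound on the probability of a correct estimate after at most `k` queries. -/
theorem log_mul_sum_measure_le (c : NoisySortingCode n) (p : unitInterval)
    (k : ℕ) :
    ENNReal.ofReal (Real.log (n ! : ℝ)) * ∑ π, (c.seedLaw.prod (noiseLaw p))
        {x | c.StoppedBy π x.1 x.2 k ∧ c.estimate x.1 (c.history π x.1 x.2 k) = π} ≤
      ENNReal.ofReal (Real.log 2 - Real.binEntropy p) *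
        (∑ π, ∫⁻ x, c.numQueries π x.1 x.2 ∂(c.seedLaw.prod (noiseLaw p))) +
      (n ! : ℝ≥0∞) * ENNReal.ofReal (Real.log 2) := by
  have hp0 : (0 : ℝ) ≤ p := p.2.1
  have hp1 : (p : ℝ) ≤ 1 := p.2.2
  have hN : 0 ≤ Real.log (n ! : ℝ) :=
    Real.log_nonneg (by exact_mod_cast Nat.factorial_pos n)
  have hd : 0 ≤ Real.log 2 - Real.binEntropy p := sub_nonneg.2 Real.binEntropy_le_log_two
  set A : Equiv.Perm (Fin n) → Set (c.Seed × (ℕ → Bool)) := fun π =>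
    {x | c.StoppedBy π x.1 x.2 k ∧ c.estimate x.1 (c.history π x.1 x.2 k) = π} with hA
  have hAm : ∀ π, MeasurableSet (A π) := fun π => measurableSet_stoppedBy_estimate c π k
  have hlm : ∀ π, Measurable fun x : c.Seed × (ℕ → Bool) =>
      ((c.history π x.1 x.2 k).length : ℝ≥0∞) := fun π =>
    (measurable_of_countable fun m : ℕ => (m : ℝ≥0∞)).comp (measurable_length_history c π k)
  have hslice : ∀ π ω, noiseLaw p (Prod.mk ω ⁻¹' A π) =
      ENNReal.ofReal (c.mean π ω p k (c.success π ω)) := by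
    intro π ω
    rw [← lintegral_history p k success_nonneg,
      ← lintegral_indicator_one (measurable_prodMk_left (hAm π))]
    refine lintegral_congr fun z => ?_
    by_cases h : c.query ω (c.history π ω z k) = none ∧ c.estimate ω (c.history π ω z k) = π
    · rw [Set.indicator_of_mem (by exact h), success, if_pos h]; simp
    · rw [Set.indicator_of_notMem (by exact h), success, if_neg h]; simp
  have hlen : ∀ π ω, ∫⁻ z, ((c.history π ω z k).length : ℝ≥0∞) ∂noiseLaw p =
      ENNReal.ofReal (c.mean π ω p k fun h => (h.length : ℝ)) := by
    intro π ω
    rw [← lintegral_history p k fun h => Nat.cast_nonneg _]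
    simp
  calc ENNReal.ofReal (Real.log (n ! : ℝ)) * ∑ π, (c.seedLaw.prod (noiseLaw p)) (A π)
      = ∫⁻ ω, ENNReal.ofReal (Real.log (n ! : ℝ)) * ∑ π, noiseLaw p (Prod.mk ω ⁻¹' A π)
          ∂c.seedLaw := by
        have hm := fun π => measurable_measure_prodMk_left (ν := noiseLaw p) (hAm π)
        rw [lintegral_const_mul _ (Finset.measurable_fun_sum _ fun π _ => hm π),
          lintegral_finsetSum _ fun π _ => hm π]
        simp only [Measure.prod_apply (hAm _)]
    _ ≤ ∫⁻ ω, (ENNReal.ofReal (Real.log 2 - Real.binEntropy p) *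
          (∑ π, ∫⁻ z, ((c.history π ω z k).length : ℝ≥0∞) ∂noiseLaw p) +
          (n ! : ℝ≥0∞) * ENNReal.ofReal (Real.log 2)) ∂c.seedLaw := by
        refine lintegral_mono fun ω => ?_
        have hs : ∀ π, 0 ≤ c.mean π ω p k (c.success π ω) := fun π =>
          mean_nonneg hp0 hp1 success_nonneg k
        have hl : ∀ π, 0 ≤ c.mean π ω p k fun h => (h.length : ℝ) := fun π =>
          mean_nonneg hp0 hp1 (fun h => Nat.cast_nonneg _) k
        simp only [hslice, hlen]
        rw [← ENNReal.ofReal_sum_of_nonneg fun π _ => hs π,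
          ← ENNReal.ofReal_sum_of_nonneg fun π _ => hl π, ← ENNReal.ofReal_mul hN,
          ← ENNReal.ofReal_mul hd, ← ENNReal.ofReal_natCast (n !),
          ← ENNReal.ofReal_mul (Nat.cast_nonneg _), ← ENNReal.ofReal_add
            (mul_nonneg hd (Finset.sum_nonneg fun π _ => hl π))
            (mul_nonneg (Nat.cast_nonneg _) (Real.log_nonneg one_le_two))]
        exact ENNReal.ofReal_le_ofReal (log_mul_sum_mean_success_le hp0 hp1 k)
    _ = ENNReal.ofReal (Real.log 2 - Real.binEntropy p) *
          (∑ π, ∫⁻ x, ((c.history π x.1 x.2 k).length : ℝ≥0∞)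
            ∂(c.seedLaw.prod (noiseLaw p))) +
          (n ! : ℝ≥0∞) * ENNReal.ofReal (Real.log 2) := by
        have hm := fun π => (hlm π).lintegral_prod_right' (ν := noiseLaw p)
        rw [lintegral_add_right _ measurable_const, lintegral_const, measure_univ, mul_one,
          lintegral_const_mul _ (Finset.measurable_fun_sum _ fun π _ => hm π),
          lintegral_finsetSum _ fun π _ => hm π]
        simp only [lintegral_prod _ (hlm _).aemeasurable]
    _ ≤ _ := by
        gcongr with π _ x
        exact length_history_le_numQueries x.2 k

end NoisySortingCode
end NoisySorting

/-! ### Unbounded horizon and conversion to bits. -/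

namespace NoisySorting
namespace NoisySortingCode

variable {n : ℕ}

theorem tendsto_measure_stoppedBy_estimate (c : NoisySortingCode n) (p : unitInterval)
    (π : Equiv.Perm (Fin n)) :
    Tendsto (fun k => (c.seedLaw.prod (noiseLaw p))
        {x | c.StoppedBy π x.1 x.2 k ∧ c.estimate x.1 (c.history π x.1 x.2 k) = π}) atTop
      (𝓝 ((c.seedLaw.prod (noiseLaw p)) {x | c.Correct π x.1 x.2})) := by
  have hU : {x : c.Seed × (ℕ → Bool) | c.Correct π x.1 x.2} =
      ⋃ k, {x | c.StoppedBy π x.1 x.2 k ∧ c.estimate x.1 (c.history π x.1 x.2 k) = π} := by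
    ext x; simp [Correct]
  rw [hU]
  -- The success events increase with `k` because the history is frozen once the agent stops.
  refine tendsto_measure_iUnion_atTop fun j k hjk x hx => ?_
  obtain ⟨hj, he⟩ : c.StoppedBy π x.1 x.2 j ∧ c.estimate x.1 (c.history π x.1 x.2 j) = π := hx
  have hh := hj.history_eq hjk
  refine ⟨?_, ?_⟩
  · rw [StoppedBy, hh]; exact hj
  · rw [hh]; exact he

theorem one_sub_errorProb_le (c : NoisySortingCode n) (p : unitInterval)
    (π : Equiv.Perm (Fin n)) :
    1 - c.errorProb p π ≤ (c.seedLaw.prod (noiseLaw p)) {x | c.Correct π x.1 x.2} := by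
  rw [tsub_le_iff_right, errorProb]
  calc (1 : ℝ≥0∞) = (c.seedLaw.prod (noiseLaw p)) Set.univ := measure_univ.symm
    _ ≤ (c.seedLaw.prod (noiseLaw p))
        ({x | c.Correct π x.1 x.2} ∪ {x | ¬ c.Correct π x.1 x.2}) :=
      measure_mono fun x _ => em (c.Correct π x.1 x.2)
    _ ≤ _ := measure_union_le _ _

/-- The converse in nats, for a code with worst-case error probability at most `δ`. -/
theorem log_mul_one_sub_le (c : NoisySortingCode n) (p : unitInterval) {δ : ℝ≥0∞}
    (hδ : ∀ π, c.errorProb p π ≤ δ) :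
    ENNReal.ofReal (Real.log (n ! : ℝ)) * (1 - δ) ≤
      ENNReal.ofReal (Real.log 2 - Real.binEntropy p) * c.expectedQueries p +
        ENNReal.ofReal (Real.log 2) := by
  set S := ∑ π : Equiv.Perm (Fin n),
    ∫⁻ x, c.numQueries π x.1 x.2 ∂(c.seedLaw.prod (noiseLaw p)) with hS
  have hn0 : (n ! : ℝ≥0∞) ≠ 0 := Nat.cast_ne_zero.2 (Nat.factorial_ne_zero n)
  have hnt : (n ! : ℝ≥0∞) ≠ ∞ := ENNReal.natCast_ne_top _
  have hE : S = n ! * c.expectedQueries p := by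
    rw [expectedQueries, ENNReal.mul_div_cancel hn0 hnt]
  have h1 : ENNReal.ofReal (Real.log (n ! : ℝ)) * ∑ π, (c.seedLaw.prod (noiseLaw p))
        {x | c.Correct π x.1 x.2} ≤
      ENNReal.ofReal (Real.log 2 - Real.binEntropy p) * S +
      (n ! : ℝ≥0∞) * ENNReal.ofReal (Real.log 2) :=
    le_of_tendsto' (ENNReal.Tendsto.const_mul
      (tendsto_finsetSum _ fun π _ => c.tendsto_measure_stoppedBy_estimate p π)
      (Or.inr ENNReal.ofReal_ne_top)) fun k => c.log_mul_sum_measure_le p k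
  have h2 : (n ! : ℝ≥0∞) * (1 - δ) ≤ ∑ π, (c.seedLaw.prod (noiseLaw p))
        {x | c.Correct π x.1 x.2} := by
    calc (n ! : ℝ≥0∞) * (1 - δ) = ∑ _π : Equiv.Perm (Fin n), (1 - δ) := by
          simp [Fintype.card_perm]
      _ ≤ _ := Finset.sum_le_sum fun π _ =>
        (tsub_le_tsub_left (hδ π) 1).trans (c.one_sub_errorProb_le p π)
  rw [← ENNReal.mul_le_mul_iff_right hn0 hnt]
  calc (n ! : ℝ≥0∞) * (ENNReal.ofReal (Real.log (n ! : ℝ)) * (1 - δ))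
      = ENNReal.ofReal (Real.log (n ! : ℝ)) * ((n ! : ℝ≥0∞) * (1 - δ)) := by ring
    _ ≤ _ := (mul_le_mul_right h2 _).trans h1
    _ = _ := by rw [hE]; ring

theorem errorProb_le_one (c : NoisySortingCode n) (p : unitInterval)
    (π : Equiv.Perm (Fin n)) : c.errorProb p π ≤ 1 := prob_le_one

/-- The converse in bits. -/
theorem ofReal_mul_logb_factorial_le (c : NoisySortingCode n) (p : unitInterval) :
    ENNReal.ofReal ((1 - ((⨆ π, c.errorProb p π).toReal + (Real.logb 2 (n ! : ℝ))⁻¹)) *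
        Real.logb 2 (n ! : ℝ)) ≤
      c.expectedQueries p * ENNReal.ofReal (1 - binaryEntropy p) := by
  set δ := ⨆ π, c.errorProb p π with hδ
  have hδ1 : δ ≤ 1 := iSup_le fun π => c.errorProb_le_one p π
  have h2 : 0 < Real.log 2 := Real.log_pos one_lt_two
  have hN : 0 ≤ Real.log (n ! : ℝ) :=
    Real.log_nonneg (by exact_mod_cast Nat.factorial_pos n)
  -- If `log₂ n! = 0` its inverse is 0 by convention and the left side vanishes; otherwise the
  -- inverse in the error term accounts for the additive bit.
  rcases eq_or_ne (Real.logb 2 (n ! : ℝ)) 0 with h0 | h0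
  · simp [h0]
  have h := c.log_mul_one_sub_le p (le_iSup fun π => c.errorProb p π)
  rw [← hδ] at h
  have hi : 0 ≤ (Real.log 2)⁻¹ := inv_nonneg.2 h2.le
  have h3 := mul_le_mul_right h (ENNReal.ofReal (Real.log 2)⁻¹)
  rw [mul_add, ← mul_assoc, ← mul_assoc, ← ENNReal.ofReal_mul hi, ← ENNReal.ofReal_mul hi,
    ← ENNReal.ofReal_mul hi, inv_mul_cancel₀ h2.ne', mul_sub, inv_mul_cancel₀ h2.ne',
    ENNReal.ofReal_one] at h3
  have e1 : (Real.log 2)⁻¹ * Real.log (n ! : ℝ) = Real.logb 2 (n ! : ℝ) := by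
    rw [Real.logb]; ring
  have e2 : (Real.log 2)⁻¹ * Real.binEntropy p = binaryEntropy p := by
    rw [binaryEntropy]; ring
  have e3 : 1 - δ = ENNReal.ofReal (1 - δ.toReal) := by
    rw [ENNReal.ofReal_sub _ ENNReal.toReal_nonneg,
      ENNReal.ofReal_toReal (hδ1.trans_lt ENNReal.one_lt_top).ne, ENNReal.ofReal_one]
  have h4 : 0 ≤ Real.logb 2 (n ! : ℝ) := by rw [← e1]; exact mul_nonneg hi hN
  rw [e1, e2, e3, ← ENNReal.ofReal_mul h4] at h3
  have e4 : (1 - (δ.toReal + (Real.logb 2 (n ! : ℝ))⁻¹)) * Real.logb 2 (n ! : ℝ) =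
      Real.logb 2 (n ! : ℝ) * (1 - δ.toReal) - 1 := by
    field_simp
    ring
  rw [e4, ENNReal.ofReal_sub _ zero_le_one, ENNReal.ofReal_one, mul_comm (c.expectedQueries p)]
  exact tsub_le_iff_right.2 h3

end NoisySortingCode

/-! ### Asymptotics and the capacity bound. -/

theorem tendsto_logb_factorial : Tendsto (fun n : ℕ => Real.logb 2 (n ! : ℝ)) atTop atTop :=
  (Real.tendsto_logb_atTop one_lt_two).comp (tendsto_atTop_mono
    (fun n => by exact_mod_cast Nat.self_le_factorial n) tendsto_natCast_atTop_atTop)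

theorem mul_log_sub_le_log_factorial (n : ℕ) :
    n * Real.log n - n ≤ Real.log (n ! : ℝ) := by
  rcases eq_or_ne n 0 with rfl | hn
  · simp
  have h := Stirling.le_log_factorial_stirling hn
  have h1 : 0 ≤ Real.log n := Real.log_natCast_nonneg n
  have h2 : 0 ≤ Real.log (2 * Real.pi) := Real.log_nonneg (by linarith [Real.pi_gt_three])
  linarith

theorem binaryEntropy_le_one (p : ℝ) : binaryEntropy p ≤ 1 :=
  (div_le_one (Real.log_pos one_lt_two)).2 Real.binEntropy_le_log_two

theorem exists_tendsto_zero_logb_factorial_le (p : unitInterval)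
    (c : (n : ℕ) → NoisySortingCode n) (hc : VanishingError p c) :
    ∃ ε : ℕ → ℝ, Tendsto ε atTop (𝓝 0) ∧
      ∀ n : ℕ, ENNReal.ofReal ((1 - ε n) * Real.logb 2 (n ! : ℝ)) ≤
        (c n).expectedQueries p * ENNReal.ofReal (1 - binaryEntropy p) := by
  refine ⟨_, ?_, fun n => (c n).ofReal_mul_logb_factorial_le p⟩
  have h1 := (ENNReal.tendsto_toReal ENNReal.zero_ne_top).comp hc
  simpa using h1.add tendsto_logb_factorial.inv_tendsto_atTop

theorem IsAchievable.le {p : unitInterval} {R : ℝ} (hR : IsAchievable p R) :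
    R ≤ 1 - binaryEntropy p := by
  obtain ⟨c, hrate, hc⟩ := hR
  have hR0 : 0 < R := (hrate 0).1
  obtain ⟨ε, hε, h⟩ := exists_tendsto_zero_logb_factorial_le p c hc
  have hH : 0 ≤ 1 - binaryEntropy p := sub_nonneg.2 (binaryEntropy_le_one p)
  have hlog : Tendsto (fun n : ℕ => Real.log n) atTop atTop :=
    Real.tendsto_log_atTop.comp tendsto_natCast_atTop_atTop
  have hlim : Tendsto (fun n : ℕ => R * ((1 - ε n) * (1 - (Real.log n)⁻¹))) atTop (𝓝 R) := by
    simpa using ((hε.const_sub 1).mul (hlog.inv_tendsto_atTop.const_sub 1)).const_mul R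
  refine le_of_tendsto hlim ?_
  -- `n ≥ 2` makes `log n` positive; `ε n ≤ 1` lets the Stirling bound be multiplied by `1 - ε n`.
  filter_upwards [eventually_ge_atTop 2, hε.eventually_le_const one_pos] with n hn hεn
  have hn' : (1 : ℝ) < n := by exact_mod_cast hn
  have hl : 0 < Real.log n := Real.log_pos hn'
  have h2 : 0 < Real.log 2 := Real.log_pos one_lt_two
  have hb : 0 ≤ n * Real.logb 2 n / R := by
    have := Real.logb_pos one_lt_two hn'
    positivity
  have h3 := h n
  rw [(hrate n).2, ← ENNReal.ofReal_mul hb, ENNReal.ofReal_le_ofReal_iff (mul_nonneg hb hH),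
    Real.logb, Real.logb] at h3
  have h4 : (1 - ε n) * Real.log (n ! : ℝ) * R ≤ n * Real.log n * (1 - binaryEntropy p) := by
    field_simp at h3
    linarith
  have h5 : (1 - ε n) * (n * Real.log n - n) * R ≤ (1 - ε n) * Real.log (n ! : ℝ) * R := by
    have := sub_nonneg.2 hεn
    gcongr
    exact mul_log_sub_le_log_factorial n
  have hpos : 0 < n * Real.log n := by positivity
  refine le_of_mul_le_mul_left ?_ hpos
  calc n * Real.log n * (R * ((1 - ε n) * (1 - (Real.log n)⁻¹)))
      = (1 - ε n) * (n * Real.log n - n) * R := by field_simp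
    _ ≤ _ := h5.trans h4

end NoisySorting

theorem theorem3 (p : unitInterval) (hp : (p : ℝ) < 1 / 2) :
    NoisySorting.capacity p ≤ ((1 - NoisySorting.binaryEntropy p : ℝ) : EReal) ∧
    ∀ c : (n : ℕ) → NoisySorting.NoisySortingCode n, NoisySorting.VanishingError p c →
      ∃ ε : ℕ → ℝ, Tendsto ε atTop (𝓝 0) ∧
        ∀ n : ℕ, ENNReal.ofReal ((1 - ε n) * Real.logb 2 (n ! : ℝ)) ≤
          (c n).expectedQueries p * ENNReal.ofReal (1 - NoisySorting.binaryEntropy p) :=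
  ⟨iSup₂_le fun _ hR => EReal.coe_le_coe_iff.2 hR.le,
    fun c hc => NoisySorting.exists_tendsto_zero_logb_factorial_le p c hc⟩
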